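/- Let $M$ be a loopless matroid of rank $r+1$ ($r\ge 0$) on a finite set $E$, with rank function $\operatorname{rk}$. Its Chow ring $A(M)$ is the quotient of the polynomial ring $\mathbb{R}[x_F : F \text{ a flat of } M,\ \emptyset\subsetneq F\subsetneq E]$ by the ideal generated by $x_Fx_G$ for all incomparable flats $F,G$ (that is, $F\not\subseteq G$ and $G\not\subseteq F$), and by $\sum_{F\ni i}x_F-\sum_{F\ni j}x_F$ for all $i,j\in E$. Let $A^r(M)$ be the image of the homogeneous polynomials of degree $r$, and for any $i\in E$ let $$\alpha=\sum_{F\ni i}x_F,\qquad \beta=\sum_{F\not\ni i}x_F$$ be the hyperplane and reciprocal hyperplane classes in $A(M)$; they do not depend on $i$. Define $\mu^0(M),\dots,\mu^r(M)$ by $$\frac{1}{q-1}\sum_{A\subseteq E}(-1)^{|A|}q^{\,r+1-\operatorname{rk}(A)}=\mu^0(M)q^r-\mu^1(M)q^{r-1}+\cdots+(-1)^r\mu^r(M).$$ Then there is a unique linear map $\deg_M:A^r(M)\to\mathbb{R}$ such that, for distinct non-empty proper flats $F_1,\dots,F_r$, $\deg_M(x_{F_1}\cdots x_{F_r})$ equals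 $1$ if $F_1,\dots,F_r$ form a flag (are totally ordered by inclusion) and $0$ otherwise; this map is an isomorphism, and $$\deg_M(\alpha^{r-k}\beta^k)=\mu^k(M)\qquad\text{for } 0\le k\le r.$$ -/

import Mathlib

noncomputable section

namespace MatroidChow

open MvPolynomial

variable {α : Type*}

/-- The rank function of a finite matroid, with natural number values. -/
def rk (M : Matroid α) (A : Set α) : ℕ := (M.eRk A).toNat

/-- The characteristic polynomial `∑_{A ⊆ E} (-1)^|A| q^(r(E) - r(A))` of a finite matroid. -/
def charPoly (M : Matroid α) [M.Finite] : Polynomial ℤ :=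
  ∑ A ∈ M.ground_finite.toFinset.powerset,
    (-1) ^ A.card * Polynomial.X ^ (rk M M.E - rk M (A : Set α))

/-- The reduced characteristic polynomial: the quotient of the characteristic polynomial
by `q - 1`. The division is exact as soon as `E` is non-empty, see `reducedCharPoly_mul`. -/
def reducedCharPoly (M : Matroid α) [M.Finite] : Polynomial ℤ :=
  charPoly M /ₘ (Polynomial.X - Polynomial.C 1)

theorem reducedCharPoly_mul (M : Matroid α) [M.Finite] (h : M.E.Nonempty) :
    (Polynomial.X - Polynomial.C 1) * reducedCharPoly M = charPoly M := by
  rw [reducedCharPoly, Polynomial.mul_divByMonic_eq_iff_isRoot, Polynomial.IsRoot, charPoly,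
    Polynomial.eval_finsetSum]
  simpa using Finset.sum_powerset_neg_one_pow_card_of_nonempty
    (x := M.ground_finite.toFinset) (by simpa using h)

/-- The number `μ^k(M)`, where
`μ^0 q^r - μ^1 q^(r-1) + ⋯ + (-1)^r μ^r` is the reduced characteristic polynomial of a
matroid `M` of rank `r + 1`. It is used for `k ≤ r` only. -/
def mu (M : Matroid α) [M.Finite] (r k : ℕ) : ℤ :=
  (-1) ^ k * (reducedCharPoly M).coeff (r - k)

/-- The non-empty proper flats of a matroid. -/
abbrev ProperFlat (M : Matroid α) : Type _ :=
  {F : Set α // M.IsFlat F ∧ F.Nonempty ∧ F ≠ M.E}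

instance (M : Matroid α) [M.Finite] : Finite (ProperFlat M) :=
  Set.Finite.to_subtype (M.ground_finite.finite_subsets.subset fun _ hF => hF.1.subset_ground)

instance (M : Matroid α) [M.Finite] : Fintype (ProperFlat M) := Fintype.ofFinite _

open Classical in
/-- The linear form `∑_{F ∋ i} x_F` in the polynomial ring on the non-empty proper flats. -/
def sumMem (M : Matroid α) [M.Finite] (i : α) : MvPolynomial (ProperFlat M) ℝ :=
  ∑ F : ProperFlat M with i ∈ F.1, X F

open Classical in
/-- The linear form `∑_{F ∌ i} x_F` in the polynomial ring on the non-empty proper flats. -/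
def sumNotMem (M : Matroid α) [M.Finite] (i : α) : MvPolynomial (ProperFlat M) ℝ :=
  ∑ F : ProperFlat M with i ∉ F.1, X F

/-- The ideal of relations of the Chow ring: `x_F x_G` for incomparable flats `F`, `G`, and
`∑_{F ∋ i} x_F - ∑_{F ∋ j} x_F` for elements `i`, `j` of the ground set. -/
def chowIdeal (M : Matroid α) [M.Finite] : Ideal (MvPolynomial (ProperFlat M) ℝ) :=
  Ideal.span
    ({p | ∃ F G : ProperFlat M, ¬ F.1 ⊆ G.1 ∧ ¬ G.1 ⊆ F.1 ∧ p = X F * X G} ∪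
      {p | ∃ i ∈ M.E, ∃ j ∈ M.E, p = sumMem M i - sumMem M j})

/-- The Chow ring `A(M)`. -/
abbrev ChowRing (M : Matroid α) [M.Finite] : Type _ :=
  MvPolynomial (ProperFlat M) ℝ ⧸ chowIdeal M

/-- The quotient map from the polynomial ring to the Chow ring. -/
def toChow (M : Matroid α) [M.Finite] : MvPolynomial (ProperFlat M) ℝ →ₐ[ℝ] ChowRing M :=
  Ideal.Quotient.mkₐ ℝ (chowIdeal M)

/-- The class of the variable `x_F` in the Chow ring. -/
def chowVar (M : Matroid α) [M.Finite] (F : ProperFlat M) : ChowRing M := toChow M (X F)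

/-- The hyperplane class `α = α_i = ∑_{F ∋ i} x_F`. -/
def hyperplaneClass (M : Matroid α) [M.Finite] (i : α) : ChowRing M := toChow M (sumMem M i)

/-- The reciprocal hyperplane class `β = β_i = ∑_{F ∌ i} x_F`. -/
def reciprocalClass (M : Matroid α) [M.Finite] (i : α) : ChowRing M := toChow M (sumNotMem M i)

/-- The hyperplane class does not depend on the chosen element of the ground set. -/
theorem hyperplaneClass_eq (M : Matroid α) [M.Finite] {i j : α} (hi : i ∈ M.E) (hj : j ∈ M.E) :
    hyperplaneClass M i = hyperplaneClass M j :=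
  Ideal.Quotient.eq.2 (Ideal.subset_span (Or.inr ⟨i, hi, j, hj, rfl⟩))

/-- The reciprocal hyperplane class does not depend on the chosen element of the ground set. -/
theorem reciprocalClass_eq (M : Matroid α) [M.Finite] {i j : α} (hi : i ∈ M.E) (hj : j ∈ M.E) :
    reciprocalClass M i = reciprocalClass M j := by
  have key : ∀ e, hyperplaneClass M e + reciprocalClass M e =
      toChow M (∑ F : ProperFlat M, X F) := fun e => by
    classical
    rw [hyperplaneClass, reciprocalClass, ← map_add, sumMem, sumNotMem]
    congr 1
    convert Finset.sum_filter_add_sum_filter_not _ _ _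
  have h := (key i).trans (key j).symm
  rw [hyperplaneClass_eq M hi hj] at h
  exact add_left_cancel h

/-- The graded piece `A^d(M)`: the classes of the homogeneous polynomials of degree `d`. -/
def chowGraded (M : Matroid α) [M.Finite] (d : ℕ) : Submodule ℝ (ChowRing M) :=
  (homogeneousSubmodule (ProperFlat M) ℝ d).map (toChow M).toLinearMap

theorem prod_mem_chowGraded (M : Matroid α) [M.Finite] {d : ℕ} (s : Finset (ProperFlat M))
    (hs : s.card = d) : ∏ F ∈ s, chowVar M F ∈ chowGraded M d := by
  refine ⟨∏ F ∈ s, X F, ?_, by simp [chowVar]⟩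
  have := IsHomogeneous.prod s (fun F : ProperFlat M => (X F : MvPolynomial _ ℝ)) (fun _ => 1)
    fun F _ => isHomogeneous_X ℝ F
  simpa [hs] using this

theorem class_mem_chowGraded (M : Matroid α) [M.Finite] {r k : ℕ} (hk : k ≤ r) (i j : α) :
    hyperplaneClass M i ^ (r - k) * reciprocalClass M j ^ k ∈ chowGraded M r := by
  refine ⟨sumMem M i ^ (r - k) * sumNotMem M j ^ k, ?_,
    by simp [hyperplaneClass, reciprocalClass]⟩
  have h1 : (sumMem M i).IsHomogeneous 1 :=
    IsHomogeneous.sum _ _ _ fun F _ => isHomogeneous_X ℝ F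
  have h2 : (sumNotMem M j).IsHomogeneous 1 :=
    IsHomogeneous.sum _ _ _ fun F _ => isHomogeneous_X ℝ F
  have := (h1.pow (r - k)).mul (h2.pow k)
  simpa [Nat.sub_add_cancel hk] using this

open Classical in
/-- A linear functional on `A^r(M)` is the degree map if a product `x_{F_1} ⋯ x_{F_r}` of `r`
distinct variables has degree `1` when `F_1, …, F_r` form a flag, and degree `0` otherwise. -/
def IsDegreeMap (M : Matroid α) [M.Finite] (r : ℕ) (deg : chowGraded M r →ₗ[ℝ] ℝ) : Prop :=
  ∀ (s : Finset (ProperFlat M)) (hs : s.card = r),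
    deg ⟨∏ F ∈ s, chowVar M F, prod_mem_chowGraded M s hs⟩ =
      if IsChain (fun F G : ProperFlat M => F.1 ⊆ G.1) (s : Set (ProperFlat M)) then 1 else 0

end MatroidChow

end

/-! Every class in degree `r` is a multiple of `α^r`. Squarefree flag monomials span
(`chowGraded_le_flagSpan`), and each complete flag monomial equals `α^r` (`flagClass_of_card_eq`):
multiplying by `α`, written with an element outside the top of a flag, only adds flats above it, and
any rank gap left below kills the product. The formula for `α^(r-k) β^k` comes from the same
calculus. Multiplication by `β`, written with an element of the bottom flat, adds flats below, and
the resulting sums obey the recursion of the Möbius function (`absMoebius_eq_sum`), whose values on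
rank `k` flats missing an element add up to `μ^k`. What remains is `α^r ≠ 0`. The Chow ring is
mapped to a quotient of the polynomial ring in variables `h_F`, defined by a functional that takes
the value `1` on monomials satisfying the dragon Hall-Rado condition and `0` on the others. There
`α` becomes `h_E`, and `h_E^r` survives. The relations needed for the map reduce to an uncrossing
argument (`dragonHallRado_or_of_join`). -/

noncomputable section

namespace MatroidChow

open MvPolynomial

/-! ### Ranks and flats -/

section Rank

variable {α : Type*} {M : Matroid α} {A B F G : Set α} {i : α}

theorem coe_rk (M : Matroid α) [M.Finite] (A : Set α) : (rk M A : ℕ∞) = M.eRk A :=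
  ENat.natCast_toNat (M.isRkFinite_set A).eRk_lt_top.ne

theorem rk_mono [M.Finite] (h : A ⊆ B) : rk M A ≤ rk M B := by
  have := M.eRk_mono h
  simp only [← coe_rk] at this
  exact_mod_cast this

theorem rk_closure : rk M (M.closure A) = rk M A := by
  rw [rk, rk, M.eRk_closure_eq]

theorem rk_empty : rk M ∅ = 0 := by simp [rk]

theorem rk_inter_add_rk_union_le [M.Finite] (A B : Set α) :
    rk M (A ∩ B) + rk M (A ∪ B) ≤ rk M A + rk M B := by
  have := M.eRk_inter_add_eRk_union_le A B
  simp only [← coe_rk] at this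
  exact_mod_cast this

theorem rk_insert [M.Finite] (hi : i ∈ M.E) (hA : i ∉ M.closure A) :
    rk M (insert i A) = rk M A + 1 := by
  have := M.eRk_insert_eq_add_one (e := i) (X := A) ⟨hi, hA⟩
  simp only [← coe_rk] at this
  exact_mod_cast this

theorem rk_insert_of_isFlat [M.Finite] (hF : M.IsFlat F) (hi : i ∈ M.E) (hA : i ∉ F) :
    rk M (insert i F) = rk M F + 1 :=
  rk_insert hi (by rwa [hF.closure])

theorem rk_lt_of_ssubset [M.Finite] (hF : M.IsFlat F) (hG : G ⊆ M.E) (h : F ⊂ G) :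
    rk M F < rk M G := by
  obtain ⟨i, hiG, hiF⟩ := Set.exists_of_ssubset h
  have := rk_mono (M := M) (Set.insert_subset hiG h.subset)
  rw [rk_insert_of_isFlat hF (hG hiG) hiF] at this
  omega

theorem eq_of_subset_of_rk_le [M.Finite] (hF : M.IsFlat F) (hG : G ⊆ M.E) (h : F ⊆ G)
    (hr : rk M G ≤ rk M F) : F = G := by
  by_contra hne
  have := rk_lt_of_ssubset hF hG (h.ssubset_of_ne hne)
  omega

theorem rk_pos [M.Finite] [M.Loopless] (hA : A ⊆ M.E) (hne : A.Nonempty) : 0 < rk M A := by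
  obtain ⟨i, hi⟩ := hne
  have h1 := M.eRk_singleton_eq (e := i) (hA hi)
  rw [← coe_rk] at h1
  have h2 := rk_mono (M := M) (Set.singleton_subset_iff.2 hi)
  have h3 : rk M {i} = 1 := by exact_mod_cast h1
  omega

theorem rk_singleton [M.Finite] [M.Loopless] (hi : i ∈ M.E) : rk M {i} = 1 := by
  have h1 := M.eRk_singleton_eq (e := i) hi
  rw [← coe_rk] at h1
  exact_mod_cast h1

theorem isFlat_empty (M : Matroid α) [M.Loopless] : M.IsFlat ∅ := by
  rw [Matroid.isFlat_iff_closure_eq, M.closure_empty, M.loops_eq_empty]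

theorem isFlat_inter (hF : M.IsFlat F) (hG : M.IsFlat G) : M.IsFlat (F ∩ G) := by
  rw [Set.inter_eq_iInter]
  exact Matroid.IsFlat.iInter (by rintro (_ | _) <;> assumption)

theorem closure_subset_flat (hG : M.IsFlat G) (h : A ⊆ G) : M.closure A ⊆ G := by
  simpa [hG.closure] using M.closure_subset_closure h

end Rank

/-! ### The dragon Hall-Rado ring -/

section Nonvanishing

variable {α : Type*} (M : Matroid α) [M.Finite]

/-- The non-empty flats of a matroid, ordered by inclusion. -/
abbrev NonemptyFlat : Type _ := {F : Set α // M.IsFlat F ∧ F.Nonempty}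

instance : Finite (NonemptyFlat M) :=
  Set.Finite.to_subtype (M.ground_finite.finite_subsets.subset fun _ hF => hF.1.subset_ground)

instance : Fintype (NonemptyFlat M) := Fintype.ofFinite _

open Classical in
/-- The number of members of a multiset of flats that are contained in a given set. -/
def countBelow (m : NonemptyFlat M →₀ ℕ) (U : Set α) : ℕ :=
  ∑ F : NonemptyFlat M with F.1 ⊆ U, m F

/-- The dragon Hall-Rado condition on a multiset of flats. -/
def DragonHallRado (m : NonemptyFlat M →₀ ℕ) : Prop :=
  ∀ U : NonemptyFlat M, countBelow M m U + 1 ≤ rk M U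

open Classical in
/-- The linear functional on polynomials in the non-empty flats which is the indicator function
of the dragon Hall-Rado condition on monomials. -/
def dragonFunctional : MvPolynomial (NonemptyFlat M) ℝ →ₗ[ℝ] ℝ :=
  (basisMonomials (NonemptyFlat M) ℝ).constr ℝ fun m => if DragonHallRado M m then 1 else 0

open Classical in
theorem dragonFunctional_monomial (m : NonemptyFlat M →₀ ℕ) :
    dragonFunctional M (monomial m 1) = if DragonHallRado M m then 1 else 0 := by
  have := (basisMonomials (NonemptyFlat M) ℝ).constr_basis ℝ
    (fun m => if DragonHallRado M m then (1 : ℝ) else 0) m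
  rwa [coe_basisMonomials] at this

/-- The largest ideal contained in the kernel of `dragonFunctional`. -/
def dragonIdeal : Ideal (MvPolynomial (NonemptyFlat M) ℝ) where
  carrier := {p | ∀ q, dragonFunctional M (p * q) = 0}
  add_mem' ha hb q := by rw [add_mul, map_add, ha, hb, add_zero]
  zero_mem' q := by rw [zero_mul, map_zero]
  smul_mem' c p hp q := by
    rw [smul_eq_mul, mul_comm c, mul_assoc]
    exact hp _

theorem mem_dragonIdeal_of_monomial {p : MvPolynomial (NonemptyFlat M) ℝ}
    (hp : ∀ m, dragonFunctional M (p * monomial m 1) = 0) : p ∈ dragonIdeal M := by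
  intro q
  induction q using MvPolynomial.induction_on' with
  | monomial m c =>
    have : monomial m c = c • monomial m (1 : ℝ) := by simp [smul_monomial]
    rw [this, mul_smul_comm, map_smul, hp, smul_zero]
  | add a b ha hb => rw [mul_add, map_add, ha, hb, add_zero]

variable {M}

theorem countBelow_add (m n : NonemptyFlat M →₀ ℕ) (U : Set α) :
    countBelow M (m + n) U = countBelow M m U + countBelow M n U := by
  simp [countBelow, Finset.sum_add_distrib]

open Classical in
theorem countBelow_single (F : NonemptyFlat M) (k : ℕ) (U : Set α) :
    countBelow M (Finsupp.single F k) U = if F.1 ⊆ U then k else 0 := by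
  rw [countBelow, Finset.sum_filter, Finset.sum_eq_single F]
  · simp
  · intro G _ hG
    simp [Finsupp.single_eq_of_ne hG]
  · simp

theorem countBelow_add_le (m : NonemptyFlat M →₀ ℕ) {U V W : Set α} (hU : U ⊆ W) (hV : V ⊆ W) :
    countBelow M m U + countBelow M m V ≤ countBelow M m W + countBelow M m (U ∩ V) := by
  classical
  simp only [countBelow, Finset.sum_filter, ← Finset.sum_add_distrib, Set.subset_inter_iff]
  refine Finset.sum_le_sum fun F _ => ?_
  by_cases h1 : F.1 ⊆ U
  · have := h1.trans hU
    by_cases h2 : F.1 ⊆ V <;> simp [h1, h2, this]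
  · by_cases h2 : F.1 ⊆ V
    · have := h2.trans hV
      simp [h1, h2, this]
    · simp [h1, h2]

theorem dragonHallRado_add_single_add_single {F G : NonemptyFlat M} {m : NonemptyFlat M →₀ ℕ} :
    open Classical in
    DragonHallRado M (Finsupp.single F 1 + Finsupp.single G 1 + m) ↔
      ∀ U : NonemptyFlat M, (if F.1 ⊆ U.1 then 1 else 0) + (if G.1 ⊆ U.1 then 1 else 0) +
        countBelow M m U + 1 ≤ rk M U := by
  simp only [DragonHallRado, countBelow_add, countBelow_single]

/-- The join of two non-empty flats. -/
def join (F G : NonemptyFlat M) : NonemptyFlat M :=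
  ⟨M.closure (F.1 ∪ G.1), M.isFlat_closure _,
    F.2.2.mono (Set.subset_union_left.trans
      (M.subset_closure _ (Set.union_subset F.2.1.subset_ground G.2.1.subset_ground)))⟩

omit [M.Finite] in
theorem join_le_iff {F G U : NonemptyFlat M} : (join F G).1 ⊆ U.1 ↔ F.1 ⊆ U.1 ∧ G.1 ⊆ U.1 := by
  rw [← Set.union_subset_iff]
  refine ⟨(M.subset_closure _ ?_).trans, closure_subset_flat U.2.1⟩
  exact Set.union_subset F.2.1.subset_ground G.2.1.subset_ground

/-- A flat containing both `F` and `G` contains their join, so either hypothesis already counts two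
there; on a flat containing only one of them, the hypothesis with that flat suffices. -/
theorem dragonHallRado_of_join {F G : NonemptyFlat M} {m : NonemptyFlat M →₀ ℕ}
    (hF : DragonHallRado M (Finsupp.single F 1 + Finsupp.single (join F G) 1 + m))
    (hG : DragonHallRado M (Finsupp.single G 1 + Finsupp.single (join F G) 1 + m)) :
    DragonHallRado M (Finsupp.single F 1 + Finsupp.single G 1 + m) := by
  classical
  rw [dragonHallRado_add_single_add_single] at *
  intro U
  have h1 := hF U
  have h2 := hG U
  simp only [join_le_iff] at h1 h2
  by_cases a : F.1 ⊆ U.1 <;> by_cases b : G.1 ⊆ U.1 <;> simp [a, b] at h1 h2 ⊢ <;> omega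

theorem DragonHallRado.of_subset {F G K : NonemptyFlat M} {m : NonemptyFlat M →₀ ℕ}
    (hK : K.1 ⊆ G.1)
    (h : DragonHallRado M (Finsupp.single F 1 + Finsupp.single K 1 + m)) :
    DragonHallRado M (Finsupp.single F 1 + Finsupp.single G 1 + m) := by
  classical
  rw [dragonHallRado_add_single_add_single] at *
  intro U
  have h1 := h U
  by_cases b : G.1 ⊆ U.1
  · simp only [b, hK.trans b, if_true] at h1 ⊢
    omega
  · simp only [b, if_false] at h1 ⊢
    omega

/-- Uncrossing. If both alternatives fail, there are flats `U` (containing `F`, not `G`) and `V`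
(containing `G`, not `F`) on which `m` is tight. Submodularity of rank and supermodularity of
`countBelow`, with the two extra units available on the join of `U` and `V`, make `m` too large on
`U ∩ V`. -/
theorem dragonHallRado_or_of_join {F G : NonemptyFlat M} {m : NonemptyFlat M →₀ ℕ}
    (h : DragonHallRado M (Finsupp.single (join F G) 1 + Finsupp.single (join F G) 1 + m)) :
    DragonHallRado M (Finsupp.single F 1 + Finsupp.single (join F G) 1 + m) ∨
      DragonHallRado M (Finsupp.single G 1 + Finsupp.single (join F G) 1 + m) := by
  classical
  by_contra! hcon
  simp only [dragonHallRado_add_single_add_single, not_forall, join_le_iff] at h hcon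
  obtain ⟨⟨U, hU⟩, ⟨V, hV⟩⟩ := hcon
  have h1 := h U
  have h2 := h V
  have a : F.1 ⊆ U.1 ∧ ¬ G.1 ⊆ U.1 := by
    by_cases a : F.1 ⊆ U.1 <;> by_cases b : G.1 ⊆ U.1 <;> simp [a, b] at h1 hU ⊢ <;> omega
  have b : G.1 ⊆ V.1 ∧ ¬ F.1 ⊆ V.1 := by
    by_cases a : F.1 ⊆ V.1 <;> by_cases b : G.1 ⊆ V.1 <;> simp [a, b] at h2 hV ⊢ <;> omega
  have h3 := h (join U V)
  have hUV := (join_le_iff (F := U) (G := V)).1 subset_rfl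
  simp only [a.1.trans hUV.1, b.1.trans hUV.2] at h3
  simp only [a.1, a.2, and_false, b.1, b.2, false_and, if_true, if_false] at h1 h2 hU hV
  simp only [and_self, if_true] at h3
  have h4 := countBelow_add_le m hUV.1 hUV.2
  have h5 := rk_inter_add_rk_union_le (M := M) U.1 V.1
  have h6 : rk M (join U V).1 = rk M (U.1 ∪ V.1) := rk_closure
  -- The condition is only imposed on non-empty flats, so an empty intersection needs the separate
  -- remark that nothing is counted below it.
  rcases Set.eq_empty_or_nonempty (U.1 ∩ V.1) with h0 | h0
  · have h7 : countBelow M m (U.1 ∩ V.1) = 0 := by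
      rw [h0, countBelow, Finset.sum_filter]
      refine Finset.sum_eq_zero fun K _ => if_neg fun hK => ?_
      exact K.2.2.ne_empty (Set.subset_empty_iff.1 hK)
    omega
  · have h7 := h ⟨U.1 ∩ V.1, isFlat_inter U.2.1 V.2.1, h0⟩
    simp only at h7
    omega

variable (M) in
/-- The quotient ring by `dragonIdeal`. -/
abbrev DragonRing : Type _ := MvPolynomial (NonemptyFlat M) ℝ ⧸ dragonIdeal M

/-- The class of a variable in `DragonRing`. -/
def dragonVar (F : NonemptyFlat M) : DragonRing M := Ideal.Quotient.mk (dragonIdeal M) (X F)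

omit [M.Finite] in
theorem X_mul_X_mul_monomial (F G : NonemptyFlat M) (m : NonemptyFlat M →₀ ℕ) :
    (X F * X G * monomial m 1 : MvPolynomial (NonemptyFlat M) ℝ) =
      monomial (Finsupp.single F 1 + Finsupp.single G 1 + m) 1 := by
  simp [X, monomial_mul]

/-- With `H` the join, expanding leaves four indicators. The condition for `FG` is the conjunction
of those for `FH` and `GH`, and the condition for `HH` is their disjunction, so the claim is `[p ∧
q] + [p ∨ q] = [p] + [q]`. -/
theorem dragonVar_sub_mul_sub (F G : NonemptyFlat M) :
    (dragonVar F - dragonVar (join F G)) * (dragonVar G - dragonVar (join F G)) = 0 := by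
  classical
  simp only [dragonVar]
  rw [← map_sub, ← map_sub, ← map_mul, Ideal.Quotient.eq_zero_iff_mem]
  refine mem_dragonIdeal_of_monomial M fun m => ?_
  set H := join F G
  have hH := (join_le_iff (F := F) (G := G)).1 subset_rfl
  have e : (X F - X H) * (X G - X H) * monomial m 1 =
      X F * X G * monomial m 1 + X H * X H * monomial m 1
        - (X F * X H * monomial m 1 + X G * X H * monomial m (1 : ℝ)) := by ring
  rw [e]
  simp only [X_mul_X_mul_monomial, map_add, map_sub, dragonFunctional_monomial]
  have h1 := dragonHallRado_of_join (F := F) (G := G) (m := m)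
  have h2 := dragonHallRado_or_of_join (F := F) (G := G) (m := m)
  have h3 := DragonHallRado.of_subset (F := F) (G := H) (K := G) (m := m) hH.2
  have h4 := DragonHallRado.of_subset (F := G) (G := H) (K := F) (m := m) hH.1
  have h5 := DragonHallRado.of_subset (F := H) (G := H) (K := F) (m := m) hH.1
  have h6 := DragonHallRado.of_subset (F := H) (G := H) (K := G) (m := m) hH.2
  rw [add_comm (Finsupp.single G 1) (Finsupp.single F 1)] at h4
  rw [add_comm (Finsupp.single H 1) (Finsupp.single F 1)] at h5
  rw [add_comm (Finsupp.single H 1) (Finsupp.single G 1)] at h6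
  by_cases a : DragonHallRado M (Finsupp.single F 1 + Finsupp.single G 1 + m)
  · simp [a, h3 a, h4 a, h5 (h3 a)]
  · by_cases b : DragonHallRado M (Finsupp.single F 1 + Finsupp.single H 1 + m)
    · have c : ¬ DragonHallRado M (Finsupp.single G 1 + Finsupp.single H 1 + m) :=
        fun c => a (h1 b c)
      simp [a, b, c, h5 b]
    · by_cases c : DragonHallRado M (Finsupp.single G 1 + Finsupp.single H 1 + m)
      · simp [a, b, c, h6 c]
      · have d : ¬ DragonHallRado M (Finsupp.single H 1 + Finsupp.single H 1 + m) :=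
          fun d => (h2 d).elim b c
        simp [a, b, c, d]

theorem dragonVar_eq_zero {F : NonemptyFlat M} (hF : rk M F ≤ 1) : dragonVar F = 0 := by
  classical
  rw [dragonVar, Ideal.Quotient.eq_zero_iff_mem]
  refine mem_dragonIdeal_of_monomial M fun m => ?_
  have e : (X F * monomial m 1 : MvPolynomial (NonemptyFlat M) ℝ) =
      monomial (Finsupp.single F 1 + m) 1 := by simp [X, monomial_mul]
  rw [e, dragonFunctional_monomial, if_neg]
  intro h
  have := h F
  simp only [countBelow_add, countBelow_single, subset_rfl, if_true] at this
  omega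

/-- The factors are counted only below the ground set itself, where the condition reads `r + 1 ≤ r +
1`. -/
theorem dragonVar_ground_pow_ne_zero [M.Loopless] {r : ℕ} (hr : rk M M.E = r + 1)
    (E : NonemptyFlat M) (hE : E.1 = M.E) : dragonVar E ^ r ≠ 0 := by
  classical
  rw [dragonVar, ← map_pow, Ne, Ideal.Quotient.eq_zero_iff_mem]
  intro h
  have h1 := h 1
  rw [mul_one, X_pow_eq_monomial, dragonFunctional_monomial, if_pos] at h1
  · exact one_ne_zero h1
  intro U
  rw [countBelow_single]
  split_ifs with hU
  · have : U.1 = M.E := U.2.1.subset_ground.antisymm (hE ▸ hU)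
    rw [this, hr]
  · have := rk_pos U.2.1.subset_ground U.2.2
    omega

end Nonvanishing

/-! ### Möbius inversion and the map from the Chow ring -/

/-- A function on a finite partial order is a sum over upper sets. -/
theorem exists_eq_sum_ge {ι A : Type*} [Fintype ι] [PartialOrder ι] [AddCommGroup A]
    [DecidableLE ι] (h : ι → A) : ∃ y : ι → A, ∀ i, h i = ∑ j with i ≤ j, y j := by
  classical
  let y : ι → A := WellFoundedGT.fix (motive := fun _ => A) fun i f =>
    h i - ∑ j : {j // i < j}, f j.1 j.2
  refine ⟨y, fun i => ?_⟩
  have e : y i = h i - ∑ j with i < j, y j := by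
    rw [Finset.sum_subtype _ (p := fun j => i < j) (by simp)]
    exact WellFoundedGT.fix_eq (motive := fun _ => A) _ i
  have hs : ({j | i ≤ j} : Finset ι) = insert i ({j | i < j} : Finset ι) := by
    ext j
    simp [le_iff_eq_or_lt, eq_comm]
  rw [hs, Finset.sum_insert (by simp), e, sub_add_cancel]

/-- Möbius inversion of the relations `(h_F - h_{F ∨ G}) (h_G - h_{F ∨ G}) = 0`. -/
theorem mul_eq_zero_of_sum_ge {ι R : Type*} [Fintype ι] [PartialOrder ι] [CommRing R]
    [DecidableLE ι] {h y : ι → R} (hy : ∀ i, h i = ∑ j with i ≤ j, y j) {sup : ι → ι → ι}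
    (hsup : ∀ i j k, sup i j ≤ k ↔ i ≤ k ∧ j ≤ k)
    (hh : ∀ i j, (h i - h (sup i j)) * (h j - h (sup i j)) = 0) {i j : ι}
    (hij : ¬ i ≤ j) (hji : ¬ j ≤ i) : y i * y j = 0 := by
  classical
  -- The induction descends from the top of the product order. In the expanded relation every term
  -- other than `y i * y j` belongs to a strictly larger incomparable pair.
  suffices H : ∀ p : ι × ι, ¬ p.1 ≤ p.2 → ¬ p.2 ≤ p.1 → y p.1 * y p.2 = 0 from H (i, j) hij hji
  intro p
  induction p using WellFoundedGT.induction with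
  | ind p ih =>
  obtain ⟨i, j⟩ := p
  intro hij hji
  have key : ∀ i j, h i - h (sup i j) = ∑ k with i ≤ k ∧ ¬ j ≤ k, y k := fun i j => by
    rw [hy, hy, sub_eq_iff_eq_add]
    simp only [hsup]
    rw [← Finset.sum_filter_add_sum_filter_not _ (fun k => j ≤ k), add_comm]
    simp only [Finset.filter_filter]
  have hcomm : h (sup i j) = h (sup j i) := by simp only [hy, hsup, and_comm]
  have h0 := hh i j
  rw [key] at h0
  rw [hcomm, key, Finset.sum_mul_sum, Finset.sum_eq_single i, Finset.sum_eq_single j] at h0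
  · exact h0
  · intro k hk hkj
    simp only [Finset.mem_filter, Finset.mem_univ, true_and] at hk
    refine ih (i, k) ?_ (fun hik => hk.2 hik) (fun hki => hji (hk.1.trans hki))
    exact Prod.mk_lt_mk.2 (Or.inr ⟨le_rfl, lt_of_le_of_ne hk.1 (Ne.symm hkj)⟩)
  · intro hj
    simp [hij] at hj
  · intro k hk hki
    simp only [Finset.mem_filter, Finset.mem_univ, true_and] at hk
    refine Finset.sum_eq_zero fun l hl => ?_
    simp only [Finset.mem_filter, Finset.mem_univ, true_and] at hl
    refine ih (k, l) ?_ (fun hkl => hl.2 (hk.1.trans hkl)) (fun hlk => hk.2 (hl.1.trans hlk))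
    exact Prod.mk_lt_mk.2 (Or.inl ⟨lt_of_le_of_ne hk.1 (Ne.symm hki), hl.1⟩)
  · intro hi
    simp [hji] at hi

section

variable {α : Type*} {M : Matroid α} [M.Finite]

/-- The map sends `x_F` to `y_F`, where `-h_F` is the sum of `y_G` over `G ⊇ F`. Since `h` vanishes
on the closure of `i`, the `y_G` with `i ∈ G` sum to zero; removing `y_E = -h_E` leaves `h_E` as the
image of `α`, whatever `i` is. -/
theorem exists_chowRing_hom [M.Loopless] (E : NonemptyFlat M) (hE : E.1 = M.E) :
    ∃ φ : ChowRing M →+* DragonRing M, ∀ i ∈ M.E, φ (hyperplaneClass M i) = dragonVar E := by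
  classical
  obtain ⟨y, hy⟩ := exists_eq_sum_ge (fun F : NonemptyFlat M => -dragonVar F)
  have hmul : ∀ F G : NonemptyFlat M, ¬ F ≤ G → ¬ G ≤ F → y F * y G = 0 := fun F G =>
    mul_eq_zero_of_sum_ge hy (sup := join) (fun F G K => join_le_iff) fun F G => by
      rw [← dragonVar_sub_mul_sub F G]
      ring
  let ψ : MvPolynomial (ProperFlat M) ℝ →ₐ[ℝ] DragonRing M :=
    aeval fun F => y ⟨F.1, F.2.1, F.2.2.1⟩
  have hmax : ∀ F : NonemptyFlat M, F ≤ E := fun F => by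
    change F.1 ⊆ E.1
    rw [hE]
    exact F.2.1.subset_ground
  have hyE : y E = -dragonVar E := by
    rw [hy, Finset.sum_eq_single E]
    · intro F hF hne
      exact absurd ((hmax F).antisymm (Finset.mem_filter.1 hF).2) hne
    · simp
  have hsum : ∀ i ∈ M.E, ψ (sumMem M i) = dragonVar E := fun i hi => by
    let I : NonemptyFlat M := ⟨M.closure {i}, M.isFlat_closure _, i,
      M.subset_closure {i} (Set.singleton_subset_iff.2 hi) rfl⟩
    have hI : ∀ F : NonemptyFlat M, I ≤ F ↔ i ∈ F.1 := fun F =>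
      ⟨fun h => h (M.subset_closure {i} (Set.singleton_subset_iff.2 hi) rfl),
        fun h => closure_subset_flat F.2.1 (Set.singleton_subset_iff.2 h)⟩
    have h0 : dragonVar I = 0 :=
      dragonVar_eq_zero (by
        change rk M (M.closure {i}) ≤ 1
        rw [rk_closure, rk_singleton hi])
    have h1 := hy I
    simp only [hI, h0, neg_zero] at h1
    rw [← Finset.sum_erase_add _ _ (a := E) (by simp [hE, hi]), hyE, ← sub_eq_add_neg,
      eq_comm, sub_eq_zero] at h1
    rw [← h1, sumMem, map_sum]
    simp only [ψ, aeval_X]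
    refine Finset.sum_bij (fun F _ => ⟨F.1, F.2.1, F.2.2.1⟩) ?_ ?_ ?_ ?_
    · intro F hF
      refine Finset.mem_erase.2 ⟨fun h => F.2.2.2 ?_, by simpa using hF⟩
      exact (congrArg (fun K : NonemptyFlat M => K.1) h).trans hE
    · intro F _ G _ h
      exact Subtype.ext (congrArg (fun K : NonemptyFlat M => K.1) h)
    · intro F hF
      obtain ⟨hne, hF⟩ := Finset.mem_erase.1 hF
      exact ⟨⟨F.1, F.2.1, F.2.2, fun h => hne (Subtype.ext (h.trans hE.symm))⟩,
        by simpa using hF, rfl⟩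
    · intro F _
      rfl
  have hker : ∀ p ∈ chowIdeal M, ψ p = 0 := by
    intro p hp
    have : chowIdeal M ≤ RingHom.ker ψ.toRingHom := by
      refine Ideal.span_le.2 ?_
      rintro p (⟨F, G, hFG, hGF, rfl⟩ | ⟨i, hi, j, hj, rfl⟩)
      · change ψ (X F * X G) = 0
        rw [map_mul, aeval_X, aeval_X]
        exact hmul _ _ hFG hGF
      · change ψ (sumMem M i - sumMem M j) = 0
        rw [map_sub, hsum i hi, hsum j hj, sub_self]
    exact this hp
  exact ⟨Ideal.Quotient.lift (chowIdeal M) ψ.toRingHom hker, hsum⟩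

theorem hyperplaneClass_pow_ne_zero [M.Loopless] {r : ℕ} (hr : rk M M.E = r + 1) {i : α}
    (hi : i ∈ M.E) : hyperplaneClass M i ^ r ≠ 0 := by
  obtain ⟨φ, hφ⟩ := exists_chowRing_hom (M := M) ⟨M.E, M.ground_isFlat, i, hi⟩ rfl
  intro h
  have h1 := congrArg φ h
  rw [map_pow, hφ i hi, map_zero] at h1
  exact dragonVar_ground_pow_ne_zero hr _ rfl h1

end

/-! ### The Möbius function and the reduced characteristic polynomial -/

section Moebius

variable {α : Type*} (M : Matroid α) [M.Finite]

open Classical in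
/-- The Möbius function `∑_{cl(A) = F} (-1)^|A|` of the lattice of flats, from the bottom to `F`. -/
def moebius (F : Set α) : ℤ :=
  ∑ A ∈ M.ground_finite.toFinset.powerset.filter
      (fun A : Finset α => M.closure (A : Set α) = F), (-1) ^ A.card

/-- The absolute value of `moebius`. -/
def absMoebius (F : Set α) : ℤ := (-1) ^ rk M F * moebius M F

variable {M}

open Classical in
-- Pair each `A` avoiding `i` with `insert i A`: the signs are opposite, and the pair cancels when
-- `i` lies in the closure of `A`.
theorem sum_powerset_eq_sum_notMem_closure {R : Type*} [CommRing R] {i : α} (hi : i ∈ M.E)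
    (f : Set α → R) (hf : ∀ A, i ∈ M.closure A → f (insert i A) = f A) :
    ∑ A ∈ M.ground_finite.toFinset.powerset, (-1) ^ A.card * f A =
      ∑ A ∈ M.ground_finite.toFinset.powerset.filter
      (fun A : Finset α => i ∉ M.closure (A : Set α)),
        (-1) ^ A.card * (f A - f (insert i (A : Set α))) := by
  have hE : M.ground_finite.toFinset = insert i (M.ground_finite.toFinset.erase i) := by
    rw [Finset.insert_erase]
    simpa using hi
  rw [Finset.sum_filter, hE, Finset.sum_powerset_insert (by simp),
    Finset.sum_powerset_insert (by simp), ← Finset.sum_add_distrib, ← Finset.sum_add_distrib]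
  refine Finset.sum_congr rfl fun A hA => ?_
  have hiA : i ∉ A := fun h => by simpa using Finset.mem_powerset.1 hA h
  have hmem : i ∈ M.closure ((insert i A : Finset α) : Set α) :=
    M.mem_closure_of_mem' (by simp) hi
  rw [if_neg (not_not.2 hmem), Finset.card_insert_of_notMem hiA, Finset.coe_insert]
  split_ifs with h
  · rw [hf _ h]
    ring
  · ring

open Classical in
theorem sum_closure_eq_sum_moebius (P : Set α → Prop) [DecidablePred P]
    (hP : ∀ F, M.IsFlat F → P F → F.Nonempty ∧ F ≠ M.E) :
    ∑ A ∈ M.ground_finite.toFinset.powerset.filter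
      (fun A : Finset α => P (M.closure (A : Set α))),
      (-1 : ℤ) ^ A.card = ∑ F : ProperFlat M with P F.1, moebius M F.1 := by
  simp only [moebius, Finset.sum_filter]
  have e : ∀ F : ProperFlat M, (if P F.1 then
      ∑ A ∈ M.ground_finite.toFinset.powerset,
        (if M.closure (A : Set α) = F.1 then (-1 : ℤ) ^ A.card else 0) else 0) =
      ∑ A ∈ M.ground_finite.toFinset.powerset,
        if M.closure (A : Set α) = F.1 ∧ P F.1 then (-1 : ℤ) ^ A.card else 0 := fun F => by
    by_cases h : P F.1 <;> simp [h]
  simp only [e]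
  rw [Finset.sum_comm]
  refine Finset.sum_congr rfl fun A _ => ?_
  split_ifs with h
  · have hF := hP _ (M.isFlat_closure A) h
    rw [Finset.sum_eq_single ⟨M.closure A, M.isFlat_closure A, hF⟩]
    · simp [h]
    · intro F _ hne
      exact if_neg fun h' => hne (Subtype.ext h'.1.symm)
    · simp
  · exact (Finset.sum_eq_zero fun F _ => if_neg fun h' => h (by rw [h'.1]; exact h'.2)).symm

open Classical in
-- This is Weisner's theorem by pairing. A set whose closure misses `i` does not span `B`, and
-- adding `i` makes it span `B` exactly when its closure lies in `B` with rank one less.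
theorem moebius_eq_neg_sum {B : Set α} (hB : M.IsFlat B) {i : α} (hi : i ∈ B) :
    moebius M B = -∑ A ∈ M.ground_finite.toFinset.powerset.filter
      (fun A : Finset α => (M.closure (A : Set α) ⊆ B ∧ i ∉ M.closure (A : Set α) ∧
        rk M (M.closure (A : Set α)) + 1 = rk M B)), (-1) ^ A.card := by
  have hiE := hB.subset_ground hi
  have h := sum_powerset_eq_sum_notMem_closure (R := ℤ) hiE
    (fun A => if M.closure A = B then 1 else 0)
    (fun A hA => by simp only [Matroid.closure_insert_eq_of_mem_closure hA])
  rw [moebius, Finset.sum_filter, ← Finset.sum_neg_distrib, Finset.sum_filter]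
  simp only [mul_ite, mul_one, mul_zero] at h
  rw [h, Finset.sum_filter]
  refine Finset.sum_congr rfl fun A hA => ?_
  have hAE : (A : Set α) ⊆ M.E := by simpa using hA
  by_cases hiA : i ∈ M.closure (A : Set α)
  · simp [hiA]
  have hne : M.closure (A : Set α) ≠ B := fun h => hiA (h ▸ hi)
  have hiff : M.closure (insert i (A : Set α)) = B ↔
      M.closure (A : Set α) ⊆ B ∧ rk M (M.closure (A : Set α)) + 1 = rk M B := by
    rw [rk_closure, ← rk_insert hiE hiA]
    constructor
    · intro h
      exact ⟨h ▸ M.closure_subset_closure (Set.subset_insert _ _), by rw [← h, rk_closure]⟩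
    · rintro ⟨h1, h2⟩
      refine eq_of_subset_of_rk_le (M.isFlat_closure _) hB.subset_ground
        (closure_subset_flat hB (Set.insert_subset hi ((M.subset_closure _ hAE).trans h1))) ?_
      rw [rk_closure, h2]
  simp only [hiA, not_false_eq_true, if_true, hne, if_false, hiff, true_and, zero_sub]
  split_ifs <;> simp

open Classical in
theorem absMoebius_eq_sum [M.Loopless] {B : Set α} (hB : M.IsFlat B) {i : α} (hi : i ∈ B)
    (hr : 2 ≤ rk M B) :
    absMoebius M B = ∑ G : ProperFlat M with (G.1 ⊆ B ∧ i ∉ G.1 ∧ rk M G.1 + 1 = rk M B),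
      absMoebius M G.1 := by
  rw [absMoebius, moebius_eq_neg_sum hB hi, sum_closure_eq_sum_moebius (M := M)
    (fun F => F ⊆ B ∧ i ∉ F ∧ rk M F + 1 = rk M B), ← Finset.sum_neg_distrib, Finset.mul_sum]
  · refine Finset.sum_congr rfl fun G hG => ?_
    rw [absMoebius, ← (Finset.mem_filter.1 hG).2.2.2]
    ring
  -- Here `2 ≤ rk M B` excludes the empty flat, which has no variable in the Chow ring.
  · rintro F hF ⟨-, h1, h2⟩
    refine ⟨Set.nonempty_iff_ne_empty.2 fun h => ?_, fun h => h1 (h ▸ hB.subset_ground hi)⟩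
    rw [h, rk_empty] at h2
    omega

theorem moebius_empty [M.Loopless] : moebius M ∅ = 1 := by
  classical
  rw [moebius, Finset.sum_filter, Finset.sum_eq_single ∅]
  · simp [M.closure_empty]
  · intro A hA hne
    refine if_neg fun h => hne ?_
    have hAE : (A : Set α) ⊆ M.E := by simpa using hA
    have := M.subset_closure _ hAE
    rw [h, Set.subset_empty_iff] at this
    exact_mod_cast this
  · simp

theorem absMoebius_of_rk_eq_one [M.Loopless] {B : Set α} (hB : M.IsFlat B) (hr : rk M B = 1) :
    absMoebius M B = 1 := by
  classical
  have hne : B.Nonempty := Set.nonempty_iff_ne_empty.2 fun h => by simp [h, rk_empty] at hr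
  obtain ⟨i, hi⟩ := hne
  rw [absMoebius, hr, moebius_eq_neg_sum hB hi, pow_one, neg_one_mul, neg_neg]
  refine Eq.trans ?_ (moebius_empty (M := M))
  rw [moebius]
  refine Finset.sum_congr (Finset.filter_congr fun A _ => ?_) fun _ _ => rfl
  rw [hr]
  constructor
  · rintro ⟨-, -, h⟩
    by_contra hne
    have := rk_pos (M.closure_subset_ground _) (Set.nonempty_iff_ne_empty.2 hne)
    omega
  · intro h
    simp [h, rk_empty]

open Classical in
-- Each surviving pair contributes `q^(n+1) - q^n`, so `q - 1` factors out term by term.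
theorem reducedCharPoly_eq_sum {r : ℕ} (hr : rk M M.E = r + 1) {i : α} (hi : i ∈ M.E) :
    reducedCharPoly M =
      ∑ A ∈ M.ground_finite.toFinset.powerset.filter
      (fun A : Finset α => i ∉ M.closure (A : Set α)),
        (-1) ^ A.card * Polynomial.X ^ (r - rk M (A : Set α)) := by
  refine mul_left_cancel₀ (Polynomial.X_sub_C_ne_zero (1 : ℤ)) ?_
  rw [reducedCharPoly_mul M ⟨i, hi⟩, charPoly, sum_powerset_eq_sum_notMem_closure hi
    (fun A => (Polynomial.X : Polynomial ℤ) ^ (rk M M.E - rk M A)), Finset.mul_sum]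
  · refine Finset.sum_congr rfl fun A hA => ?_
    obtain ⟨hA, hiA⟩ := Finset.mem_filter.1 hA
    have hAE : (A : Set α) ⊆ M.E := by simpa using hA
    have h1 := rk_insert hi hiA
    have h2 := rk_mono (M := M) (Set.insert_subset hi hAE)
    rw [h1, hr] at *
    rw [show r + 1 - rk M (A : Set α) = r - rk M (A : Set α) + 1 by omega,
      show r + 1 - (rk M (A : Set α) + 1) = r - rk M (A : Set α) by omega, pow_succ, map_one]
    ring
  · intro A hA
    have : rk M (insert i A) = rk M A := by
      rw [← rk_closure, Matroid.closure_insert_eq_of_mem_closure hA, rk_closure]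
    simp only [this]

open Classical in
theorem mu_eq_sum {r k : ℕ} (hr : rk M M.E = r + 1) (hk : k ≤ r) {i : α} (hi : i ∈ M.E) :
    mu M r k = (-1) ^ k * ∑ A ∈ M.ground_finite.toFinset.powerset.filter
      (fun A : Finset α => (i ∉ M.closure (A : Set α) ∧ rk M (M.closure (A : Set α)) = k)), (-1) ^ A.card := by
  rw [mu, reducedCharPoly_eq_sum hr hi, Polynomial.finsetSum_coeff, Finset.sum_filter,
    Finset.sum_filter]
  congr 1
  refine Finset.sum_congr rfl fun A hA => ?_
  have hAE : (A : Set α) ⊆ M.E := by simpa using hA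
  by_cases hiA : i ∈ M.closure (A : Set α)
  · simp [hiA]
  have h1 := rk_insert hi hiA
  have h2 := rk_mono (M := M) (Set.insert_subset hi hAE)
  have hC : ((-1) ^ A.card : Polynomial ℤ) = Polynomial.C ((-1) ^ A.card) := by simp
  rw [hC, Polynomial.coeff_C_mul, Polynomial.coeff_X_pow, rk_closure]
  -- Truncated subtraction loses nothing: since `i` is outside the closure of `A`, the rank of `A`
  -- is at most `r`.
  have h3 : r - k = r - rk M (A : Set α) ↔ rk M (A : Set α) = k := by omega
  simp [hiA, h3]

open Classical in
theorem mu_eq_sum_absMoebius [M.Loopless] {r k : ℕ} (hr : rk M M.E = r + 1) (hk : k ≤ r)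
    (hk0 : k ≠ 0) {i : α} (hi : i ∈ M.E) :
    mu M r k = ∑ F : ProperFlat M with (i ∉ F.1 ∧ rk M F.1 = k), absMoebius M F.1 := by
  rw [mu_eq_sum hr hk hi, sum_closure_eq_sum_moebius (M := M) (fun F => i ∉ F ∧ rk M F = k),
    Finset.mul_sum]
  · refine Finset.sum_congr rfl fun G hG => ?_
    rw [absMoebius, (Finset.mem_filter.1 hG).2.2]
  · rintro F hF ⟨h1, h2⟩
    refine ⟨Set.nonempty_iff_ne_empty.2 fun h => hk0 ?_, fun h => h1 (h ▸ hi)⟩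
    rw [← h2, h, rk_empty]

theorem mu_zero [M.Loopless] {r : ℕ} (hr : rk M M.E = r + 1) {i : α} (hi : i ∈ M.E) :
    mu M r 0 = 1 := by
  classical
  rw [mu_eq_sum hr (Nat.zero_le r) hi, pow_zero, one_mul]
  refine Eq.trans ?_ (moebius_empty (M := M))
  rw [moebius]
  refine Finset.sum_congr (Finset.filter_congr fun A _ => ?_) fun _ _ => rfl
  constructor
  · rintro ⟨-, h⟩
    by_contra hne
    have := rk_pos (M.closure_subset_ground _) (Set.nonempty_iff_ne_empty.2 hne)
    omega
  · intro h
    simp [h, rk_empty]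

end Moebius

/-! ### Flags and their monomials -/

section Flags

variable {α : Type*} {M : Matroid α} [M.Finite]

/-- Sets of non-empty proper flats that are totally ordered by inclusion. -/
abbrev IsFlag (s : Finset (ProperFlat M)) : Prop :=
  IsChain (fun F G : ProperFlat M => F.1 ⊆ G.1) (s : Set (ProperFlat M))

/-- The largest member of a flag of non-empty proper flats, where `∅` is added to the flag. -/
structure IsTop (s : Finset (ProperFlat M)) (T : Set α) : Prop where
  isFlat : M.IsFlat T
  ne_ground : T ≠ M.E
  subset : ∀ F ∈ s, F.1 ⊆ T
  eq_or_mem : T = ∅ ∨ ∃ F ∈ s, F.1 = T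

/-- The product of the variables in a set of flats. -/
def flagClass (s : Finset (ProperFlat M)) : ChowRing M := ∏ F ∈ s, chowVar M F

omit [M.Finite] in
theorem IsFlag.subset_or_subset {s : Finset (ProperFlat M)} (hs : IsFlag s) {F G : ProperFlat M}
    (hF : F ∈ s) (hG : G ∈ s) : F.1 ⊆ G.1 ∨ G.1 ⊆ F.1 := by
  by_cases h : F = G
  · exact Or.inl (h ▸ subset_rfl)
  · exact hs hF hG h

omit [M.Finite] in
open Classical in
theorem IsFlag.insert_of_comparable {s : Finset (ProperFlat M)} (hs : IsFlag s) {G : ProperFlat M}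
    (hG : ∀ F ∈ s, F.1 ⊆ G.1 ∨ G.1 ⊆ F.1) : IsFlag (insert G s) := by
  rw [IsFlag, Finset.coe_insert]
  exact hs.insert fun F hF _ => (hG F hF).symm

omit [M.Finite] in
theorem IsFlag.mono {s t : Finset (ProperFlat M)} (hs : IsFlag s) (h : t ⊆ s) : IsFlag t :=
  IsChain.mono (by exact_mod_cast h) hs

theorem IsFlag.card_add_le {s : Finset (ProperFlat M)} (hs : IsFlag s) {a b : ℕ}
    (hab : ∀ F ∈ s, a ≤ rk M F.1 ∧ rk M F.1 ≤ b) : s.card ≤ b + 1 - a := by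
  rw [← Nat.card_Icc]
  refine Finset.card_le_card_of_injOn (fun F => rk M F.1)
    (fun F hF => Finset.mem_coe.2 (Finset.mem_Icc.2 (hab F hF))) ?_
  intro F hF G hG h
  have h' : rk M F.1 = rk M G.1 := h
  apply Subtype.ext
  rcases hs.subset_or_subset hF hG with hFG | hGF
  · exact eq_of_subset_of_rk_le F.2.1 G.2.1.subset_ground hFG h'.ge
  · exact (eq_of_subset_of_rk_le G.2.1 F.2.1.subset_ground hGF h'.le).symm

theorem rk_properFlat_pos [M.Loopless] (F : ProperFlat M) : 1 ≤ rk M F.1 :=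
  rk_pos F.2.1.subset_ground F.2.2.1

theorem rk_lt_rk_ground {T : Set α} (hT : M.IsFlat T) (hne : T ≠ M.E) :
    rk M T < rk M M.E :=
  rk_lt_of_ssubset hT subset_rfl (hT.subset_ground.ssubset_of_ne hne)

theorem IsFlag.exists_isTop [M.Loopless] (hE : M.E.Nonempty) {s : Finset (ProperFlat M)}
    (hs : IsFlag s) : ∃ T, IsTop s T := by
  rcases s.eq_empty_or_nonempty with rfl | hne
  · exact ⟨∅, isFlat_empty M, hE.ne_empty.symm, by simp, Or.inl rfl⟩
  · obtain ⟨T, hT, hmax⟩ := s.exists_max_image (fun F => rk M F.1) hne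
    refine ⟨T.1, T.2.1, T.2.2.2, fun F hF => ?_, Or.inr ⟨T, hT, rfl⟩⟩
    rcases hs.subset_or_subset hF hT with h | h
    · exact h
    · exact (eq_of_subset_of_rk_le T.2.1 F.2.1.subset_ground h (hmax F hF)).ge

theorem IsFlag.card_le_rk [M.Loopless] {s : Finset (ProperFlat M)} (hs : IsFlag s) {T : Set α}
    (hT : ∀ F ∈ s, F.1 ⊆ T) : s.card ≤ rk M T := by
  have := hs.card_add_le (a := 1) (b := rk M T) fun F hF =>
    ⟨rk_properFlat_pos F, rk_mono (hT F hF)⟩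
  omega

omit [M.Finite] in
open Classical in
theorem IsTop.insert_top {s : Finset (ProperFlat M)} {T : Set α} (hT : IsTop s T) {G : ProperFlat M}
    (hG : T ⊆ G.1) : IsTop (insert G s) G.1 where
  isFlat := G.2.1
  ne_ground := G.2.2.2
  subset F hF := by
    rcases Finset.mem_insert.1 hF with rfl | hF
    · exact subset_rfl
    · exact (hT.subset F hF).trans hG
  eq_or_mem := Or.inr ⟨G, Finset.mem_insert_self _ _, rfl⟩

omit [M.Finite] in
open Classical in
theorem IsTop.insert_of_subset {s : Finset (ProperFlat M)} {T : Set α} (hT : IsTop s T)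
    {G : ProperFlat M} (hG : G.1 ⊆ T) : IsTop (insert G s) T where
  isFlat := hT.isFlat
  ne_ground := hT.ne_ground
  subset F hF := by
    rcases Finset.mem_insert.1 hF with rfl | hF
    · exact hG
    · exact hT.subset F hF
  eq_or_mem := hT.eq_or_mem.imp_right fun ⟨F, hF, h⟩ => ⟨F, Finset.mem_insert_of_mem hF, h⟩

theorem chowVar_mul_chowVar {F G : ProperFlat M} (h1 : ¬ F.1 ⊆ G.1) (h2 : ¬ G.1 ⊆ F.1) :
    chowVar M F * chowVar M G = 0 := by
  rw [chowVar, chowVar, ← map_mul]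
  exact Ideal.Quotient.eq_zero_iff_mem.2 (Ideal.subset_span (Or.inl ⟨F, G, h1, h2, rfl⟩))

theorem chowVar_mul_flagClass {s : Finset (ProperFlat M)} {F G : ProperFlat M} (hG : G ∈ s)
    (h1 : ¬ F.1 ⊆ G.1) (h2 : ¬ G.1 ⊆ F.1) : chowVar M F * flagClass s = 0 := by
  classical
  rw [flagClass, ← Finset.mul_prod_erase s _ hG, ← mul_assoc, chowVar_mul_chowVar h1 h2,
    zero_mul]

open Classical in
theorem flagClass_insert {s : Finset (ProperFlat M)} {G : ProperFlat M} (hG : G ∉ s) :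
    flagClass (insert G s) = chowVar M G * flagClass s :=
  Finset.prod_insert hG

theorem flagClass_eq_zero {s : Finset (ProperFlat M)} (hs : ¬ IsFlag s) : flagClass s = 0 := by
  classical
  simp only [IsFlag, IsChain, Set.Pairwise, not_forall] at hs
  obtain ⟨F, hF, G, hG, hne, h⟩ := hs
  rw [not_or] at h
  have hF' : F ∈ s.erase G := Finset.mem_erase.2 ⟨hne, hF⟩
  rw [← Finset.insert_erase (Finset.mem_coe.1 hG), flagClass_insert (Finset.notMem_erase _ _)]
  exact chowVar_mul_flagClass hF' h.2 h.1

open Classical in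
theorem hyperplaneClass_eq_sum (i : α) :
    hyperplaneClass M i = ∑ F : ProperFlat M with i ∈ F.1, chowVar M F := by
  simp only [hyperplaneClass, sumMem, map_sum, chowVar]

open Classical in
theorem reciprocalClass_eq_sum (i : α) :
    reciprocalClass M i = ∑ F : ProperFlat M with i ∉ F.1, chowVar M F := by
  simp only [reciprocalClass, sumNotMem, map_sum, chowVar]

open Classical in
-- A flat containing `i ∉ T` lies in no member of the flag, so it is either above `T` or
-- incomparable to `T`; hence no squares appear.
theorem hyperplaneClass_mul_flagClass {s : Finset (ProperFlat M)} {T : Set α} (hT : IsTop s T)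
    {i : α} (hi : i ∉ T) : hyperplaneClass M i * flagClass s =
      ∑ G : ProperFlat M with (i ∈ G.1 ∧ T ⊆ G.1), flagClass (insert G s) := by
  rw [hyperplaneClass_eq_sum, Finset.sum_mul, ← Finset.filter_filter, Finset.sum_filter]
  conv_rhs => rw [Finset.sum_filter]
  rw [Finset.sum_filter]
  refine Finset.sum_congr rfl fun G _ => ?_
  by_cases hG : i ∈ G.1
  · simp only [hG, if_true]
    split_ifs with hTG
    · exact (flagClass_insert fun h => hi (hT.subset G h hG)).symm
    · rcases hT.eq_or_mem with rfl | ⟨F, hF, rfl⟩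
      · exact absurd (Set.empty_subset _) hTG
      · exact chowVar_mul_flagClass hF (fun h => hi (h hG)) hTG
  · simp [hG]

open Classical in
theorem reciprocalClass_mul_flagClass {s : Finset (ProperFlat M)} {B : ProperFlat M} (hB : B ∈ s)
    (hsB : ∀ F ∈ s, B.1 ⊆ F.1) {i : α} (hi : i ∈ B.1) : reciprocalClass M i * flagClass s =
      ∑ G : ProperFlat M with (i ∉ G.1 ∧ G.1 ⊆ B.1), flagClass (insert G s) := by
  rw [reciprocalClass_eq_sum, Finset.sum_mul, ← Finset.filter_filter, Finset.sum_filter]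
  conv_rhs => rw [Finset.sum_filter]
  rw [Finset.sum_filter]
  refine Finset.sum_congr rfl fun G _ => ?_
  by_cases hG : i ∉ G.1
  · simp only [hG, not_false_eq_true, if_true]
    split_ifs with hGB
    · exact (flagClass_insert fun h => hG (hsB G h hi)).symm
    · exact chowVar_mul_flagClass hB hGB fun h => hG (h hi)
  · simp [hG]

end Flags

/-! ### Intersection numbers as multiples of `α^r` -/

section Degree

variable {α : Type*} {M : Matroid α} [M.Finite] [M.Loopless] {r : ℕ} {e : α}

omit [M.Loopless] in
-- A gap below the top is never filled: each factor `α` adds one flat and raises the top rank by at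
-- least one. After all `m` factors the flag has `r` members, but a proper flat cannot have rank
-- above `r`.
theorem hyperplaneClass_pow_mul_eq_zero (hr : rk M M.E = r + 1) (he : e ∈ M.E) :
    ∀ (m : ℕ) (s : Finset (ProperFlat M)) (T : Set α), IsTop s T → s.card + m = r →
      s.card < rk M T → hyperplaneClass M e ^ m * flagClass s = 0
  | 0, s, T, hT, hc, hlt => by
    have := rk_lt_rk_ground hT.isFlat hT.ne_ground
    omega
  | m + 1, s, T, hT, hc, hlt => by
    classical
    obtain ⟨i, hiE, hiT⟩ := Set.exists_of_ssubset
      (hT.isFlat.subset_ground.ssubset_of_ne hT.ne_ground)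
    rw [pow_succ, mul_assoc, hyperplaneClass_eq M he hiE, hyperplaneClass_mul_flagClass hT hiT,
      Finset.mul_sum, ← hyperplaneClass_eq M he hiE]
    refine Finset.sum_eq_zero fun G hG => ?_
    obtain ⟨hiG, hTG⟩ := (Finset.mem_filter.1 hG).2
    have hGs : G ∉ s := fun h => hiT (hT.subset G h hiG)
    have hlt' := rk_lt_of_ssubset hT.isFlat G.2.1.subset_ground
      (hTG.ssubset_of_ne fun h => hiT (h ▸ hiG))
    refine hyperplaneClass_pow_mul_eq_zero hr he m _ _ (hT.insert_top hTG) ?_ ?_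
    · rw [Finset.card_insert_of_notMem hGs]
      omega
    · rw [Finset.card_insert_of_notMem hGs]
      omega

omit [M.Loopless] in
open Classical in
-- Write `α` with an element of `K` outside `T`. Every new top then contains `K`, and a strictly
-- larger one creates a gap, so its term vanishes.
theorem hyperplaneClass_pow_succ_mul (hr : rk M M.E = r + 1) (he : e ∈ M.E) {m : ℕ}
    {s : Finset (ProperFlat M)} {T : Set α} (hT : IsTop s T) (hc : s.card + (m + 1) = r)
    (hrk : rk M T = s.card) {K : ProperFlat M} (hTK : T ⊆ K.1) (hK : rk M K.1 = rk M T + 1) :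
    hyperplaneClass M e ^ (m + 1) * flagClass s =
      hyperplaneClass M e ^ m * flagClass (insert K s) := by
  obtain ⟨i, hiK, hiT⟩ : ∃ i ∈ K.1, i ∉ T := by
    by_contra! h
    rw [hTK.antisymm h] at hK
    omega
  have hiE := K.2.1.subset_ground hiK
  rw [pow_succ, mul_assoc, hyperplaneClass_eq M he hiE, hyperplaneClass_mul_flagClass hT hiT,
    Finset.mul_sum, Finset.sum_eq_single K]
  · intro G hG hne
    obtain ⟨hiG, hTG⟩ := (Finset.mem_filter.1 hG).2
    have hGs : G ∉ s := fun h => hiT (hT.subset G h hiG)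
    have hcl : M.closure (insert i T) = K.1 := by
      refine eq_of_subset_of_rk_le (M.isFlat_closure _) K.2.1.subset_ground
        (closure_subset_flat K.2.1 (Set.insert_subset hiK hTK)) ?_
      rw [rk_closure, rk_insert_of_isFlat hT.isFlat hiE hiT, hK]
    have hKG : K.1 ⊆ G.1 := hcl ▸ closure_subset_flat G.2.1 (Set.insert_subset hiG hTG)
    have hlt := rk_lt_of_ssubset K.2.1 G.2.1.subset_ground
      (hKG.ssubset_of_ne fun h => hne (Subtype.ext h.symm))
    refine hyperplaneClass_pow_mul_eq_zero hr hiE m _ _ (hT.insert_top hTG) ?_ ?_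
    · rw [Finset.card_insert_of_notMem hGs]
      omega
    · rw [Finset.card_insert_of_notMem hGs]
      omega
  · intro h
    simp [hiK, hTK] at h

theorem hyperplaneClass_pow_mul_eq_pow (hr : rk M M.E = r + 1) (he : e ∈ M.E) :
    ∀ (n m : ℕ) (s : Finset (ProperFlat M)) (T : Set α), IsFlag s → IsTop s T → s.card = n →
      n + m = r → rk M T = n →
        hyperplaneClass M e ^ m * flagClass s = hyperplaneClass M e ^ r
  | 0, m, s, T, hs, hT, hc, hnm, hrk => by
    rw [Finset.card_eq_zero.1 hc, flagClass, Finset.prod_empty, mul_one, ← hnm, zero_add]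
  | n + 1, m, s, T, hs, hT, hc, hnm, hrk => by
    classical
    obtain ⟨K, hK, rfl⟩ := hT.eq_or_mem.resolve_left fun h => by
      rw [h, rk_empty] at hrk
      omega
    have hc' := Finset.card_erase_of_mem hK
    have hs' : IsFlag (s.erase K) := hs.mono (Finset.erase_subset _ _)
    obtain ⟨T', hT'⟩ := hs'.exists_isTop ⟨e, he⟩
    have hss : T' ⊂ K.1 := by
      rcases hT'.eq_or_mem with rfl | ⟨F, hF, rfl⟩
      · exact Set.empty_ssubset.2 K.2.2.1
      · exact (hT.subset F (Finset.mem_of_mem_erase hF)).ssubset_of_ne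
          fun h => Finset.ne_of_mem_erase hF (Subtype.ext h)
    have h1 := hs'.card_le_rk hT'.subset
    have h2 := rk_lt_of_ssubset hT'.isFlat K.2.1.subset_ground hss
    rw [← Finset.insert_erase hK, ← hyperplaneClass_pow_succ_mul hr he hT' (by omega) (by omega)
      hss.subset (by omega)]
    exact hyperplaneClass_pow_mul_eq_pow hr he n (m + 1) _ T' hs' hT' (by omega) (by omega)
      (by omega)

theorem flagClass_of_card_eq (hr : rk M M.E = r + 1) (he : e ∈ M.E) {s : Finset (ProperFlat M)}
    (hs : IsFlag s) (hc : s.card = r) : flagClass s = hyperplaneClass M e ^ r := by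
  obtain ⟨T, hT⟩ := hs.exists_isTop ⟨e, he⟩
  have h1 := hs.card_le_rk hT.subset
  have h2 := rk_lt_rk_ground hT.isFlat hT.ne_ground
  have := hyperplaneClass_pow_mul_eq_pow hr he r 0 s T hs hT hc (by omega) (by omega)
  rwa [pow_zero, one_mul] at this

/-- The rank conditions say that `s` has no gaps from rank `k + 1` up to its top, so the `k` factors
`β` must fill exactly the ranks `1, …, k`. Writing `β` with an element of `B` reproduces the
recursion `absMoebius_eq_sum`. -/
theorem pow_mul_pow_mul_flagClass (hr : rk M M.E = r + 1) (he : e ∈ M.E) (m : ℕ) :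
    ∀ (k : ℕ) (s : Finset (ProperFlat M)) (T : Set α) (B : ProperFlat M), IsFlag s → IsTop s T →
      B ∈ s → (∀ F ∈ s, B.1 ⊆ F.1) → s.card + k + m = r →
        hyperplaneClass M e ^ m * reciprocalClass M e ^ k * flagClass s =
          (if rk M B.1 = k + 1 ∧ rk M T = k + s.card then (absMoebius M B.1 : ℝ) else 0) •
            hyperplaneClass M e ^ r
  | 0, s, T, B, hs, hT, hB, hsB, hc => by
    have h1 := hs.card_le_rk hT.subset
    rw [pow_zero, mul_one]
    by_cases h : rk M T = s.card
    · have h2 := hs.card_add_le (a := rk M B.1) (b := rk M T) fun F hF =>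
        ⟨rk_mono (hsB F hF), rk_mono (hT.subset F hF)⟩
      have h3 := rk_properFlat_pos B
      have h4 := rk_mono (M := M) (hT.subset B hB)
      have h5 : rk M B.1 = 1 := by omega
      rw [if_pos ⟨by omega, by omega⟩, absMoebius_of_rk_eq_one B.2.1 h5, Int.cast_one, one_smul]
      exact hyperplaneClass_pow_mul_eq_pow hr he _ m s T hs hT rfl (by omega) h
    · rw [if_neg (by omega), zero_smul]
      exact hyperplaneClass_pow_mul_eq_zero hr he m s T hT (by omega) (by omega)
  | k + 1, s, T, B, hs, hT, hB, hsB, hc => by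
    classical
    obtain ⟨i, hi⟩ := B.2.2.1
    have hiE := B.2.1.subset_ground hi
    have h2 := hs.card_add_le (a := rk M B.1) (b := rk M T) fun F hF =>
      ⟨rk_mono (hsB F hF), rk_mono (hT.subset F hF)⟩
    have h4 := rk_mono (M := M) (hT.subset B hB)
    have hpos : 0 < s.card := Finset.card_pos.2 ⟨B, hB⟩
    rw [pow_succ, mul_assoc, mul_assoc, reciprocalClass_eq M he hiE,
      reciprocalClass_mul_flagClass hB hsB hi, Finset.mul_sum, Finset.mul_sum,
      ← reciprocalClass_eq M he hiE]
    have step : ∀ G : ProperFlat M, i ∉ G.1 ∧ G.1 ⊆ B.1 →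
        hyperplaneClass M e ^ m * (reciprocalClass M e ^ k * flagClass (insert G s)) =
          (if rk M G.1 = k + 1 ∧ rk M T = k + 1 + s.card then (absMoebius M G.1 : ℝ) else 0) •
            hyperplaneClass M e ^ r := fun G hG => by
      have hGs : G ∉ s := fun h => hG.1 (hsB G h hi)
      have hcard := Finset.card_insert_of_notMem hGs
      rw [← mul_assoc, pow_mul_pow_mul_flagClass hr he m k (insert G s) T G
        (hs.insert_of_comparable fun F hF => Or.inr (hG.2.trans (hsB F hF)))
        (hT.insert_of_subset (hG.2.trans (hT.subset B hB))) (Finset.mem_insert_self _ _) ?_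
        (by omega), hcard]
      · simp only [add_assoc, add_comm 1]
      · intro F hF
        rcases Finset.mem_insert.1 hF with rfl | hF
        · exact subset_rfl
        · exact hG.2.trans (hsB F hF)
    rw [Finset.sum_congr rfl fun G hG => step G (Finset.mem_filter.1 hG).2, ← Finset.sum_smul]
    congr 1
    by_cases h : rk M B.1 = k + 1 + 1 ∧ rk M T = k + 1 + s.card
    · rw [if_pos h, absMoebius_eq_sum B.2.1 hi (by omega), Int.cast_sum, ← Finset.sum_filter,
        Finset.filter_filter]
      refine Finset.sum_congr (Finset.filter_congr fun G _ => ?_) fun _ _ => rfl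
      rw [h.1]
      constructor
      · rintro ⟨⟨h1, h2⟩, h3, -⟩
        exact ⟨h2, h1, by omega⟩
      · rintro ⟨h1, h2, h3⟩
        exact ⟨⟨h2, h1⟩, by omega, h.2⟩
    · rw [if_neg h]
      -- If some `G` qualified, then `rk B > rk G = k + 1`, while `s.card` flats fit between `B` and
      -- `T` only if `rk B ≤ k + 2`; so the excluded condition would hold.
      refine Finset.sum_eq_zero fun G hG => if_neg fun hG' => h ?_
      obtain ⟨hiG, hGB⟩ := (Finset.mem_filter.1 hG).2
      have := rk_lt_of_ssubset G.2.1 B.2.1.subset_ground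
        (hGB.ssubset_of_ne fun h => hiG (h ▸ hi))
      omega

theorem pow_mul_pow_eq_mu_smul (hr : rk M M.E = r + 1) (he : e ∈ M.E) {k : ℕ} (hk : k ≤ r) :
    hyperplaneClass M e ^ (r - k) * reciprocalClass M e ^ k =
      (mu M r k : ℝ) • hyperplaneClass M e ^ r := by
  classical
  rcases k with - | k
  · rw [mu_zero hr he, pow_zero, mul_one, Int.cast_one, one_smul, Nat.sub_zero]
  rw [mu_eq_sum_absMoebius hr hk (Nat.succ_ne_zero k) he, pow_succ, ← mul_assoc]
  -- Only one factor `β` is expanded, to create the bottom flat that the previous lemma needs. It is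
  -- written with `e`, matching the formula for `mu`.
  nth_rw 2 [reciprocalClass_eq_sum]
  rw [Finset.mul_sum, Int.cast_sum, Finset.sum_smul, ← Finset.filter_filter]
  conv_rhs => rw [Finset.sum_filter]
  refine Finset.sum_congr rfl fun G _ => ?_
  have hG : IsTop {G} G.1 :=
    ⟨G.2.1, G.2.2.2, by simp, Or.inr ⟨G, by simp, rfl⟩⟩
  have := pow_mul_pow_mul_flagClass hr he (r - (k + 1)) k {G} G.1 G (by simp [IsFlag]) hG
    (by simp) (by simp) (by simp; omega)
  rw [flagClass, Finset.prod_singleton] at this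
  rw [this]
  simp only [Finset.card_singleton, and_self]
  split_ifs <;> simp

end Degree

/-! ### Squarefree flag monomials span -/

section Spanning

variable {α : Type*} (M : Matroid α) [M.Finite]

/-- The span of the squarefree monomials of degree `d` supported on flags. -/
def flagSpan (d : ℕ) : Submodule ℝ (ChowRing M) :=
  Submodule.span ℝ {x | ∃ s : Finset (ProperFlat M), IsFlag s ∧ s.card = d ∧ flagClass s = x}

variable {M}

theorem chowVar_mul_flagClass_mem_of_notMem {s : Finset (ProperFlat M)} {F : ProperFlat M}
    (hF : F ∉ s) : chowVar M F * flagClass s ∈ flagSpan M (s.card + 1) := by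
  classical
  rw [← flagClass_insert hF]
  by_cases h : IsFlag (insert F s)
  · exact Submodule.subset_span ⟨_, h, Finset.card_insert_of_notMem hF, rfl⟩
  · rw [flagClass_eq_zero h]
    exact zero_mem _

theorem IsFlag.exists_mem_notMem [M.Loopless] {s : Finset (ProperFlat M)} (hs : IsFlag s)
    (F : ProperFlat M) : ∃ i ∈ F.1, ∀ G ∈ s, G.1 ⊂ F.1 → i ∉ G.1 := by
  classical
  have hs' : IsFlag ({G ∈ s | G.1 ⊂ F.1} : Finset (ProperFlat M)) :=
    hs.mono (Finset.filter_subset _ _)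
  obtain ⟨T, hT⟩ := hs'.exists_isTop (F.2.2.1.mono F.2.1.subset_ground)
  have hTF : T ⊂ F.1 := by
    rcases hT.eq_or_mem with rfl | ⟨G, hG, rfl⟩
    · exact Set.empty_ssubset.2 F.2.2.1
    · exact (Finset.mem_filter.1 hG).2
  obtain ⟨i, hiF, hiT⟩ := Set.exists_of_ssubset hTF
  exact ⟨i, hiF, fun G hG hGF hi => hiT (hT.subset G (Finset.mem_filter.2 ⟨hG, hGF⟩) hi)⟩

theorem IsFlag.exists_notMem_mem {s : Finset (ProperFlat M)} (hs : IsFlag s)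
    (F : ProperFlat M) : ∃ j ∈ M.E, j ∉ F.1 ∧ ∀ G ∈ s, F.1 ⊂ G.1 → j ∈ G.1 := by
  classical
  rcases Finset.eq_empty_or_nonempty ({G ∈ s | F.1 ⊂ G.1} : Finset (ProperFlat M)) with h | h
  · obtain ⟨j, hj, hjF⟩ := Set.exists_of_ssubset
      (F.2.1.subset_ground.ssubset_of_ne F.2.2.2)
    exact ⟨j, hj, hjF, fun G hG hFG =>
      absurd (Finset.mem_filter.2 ⟨hG, hFG⟩) (h ▸ Finset.notMem_empty G)⟩
  · obtain ⟨K, hK, hmin⟩ := Finset.exists_min_image _ (fun G => rk M G.1) h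
    obtain ⟨hKs, hFK⟩ := Finset.mem_filter.1 hK
    obtain ⟨j, hjK, hjF⟩ := Set.exists_of_ssubset hFK
    refine ⟨j, K.2.1.subset_ground hjK, hjF, fun G hG hFG => ?_⟩
    rcases hs.subset_or_subset hKs hG with h1 | h1
    · exact h1 hjK
    · rw [eq_of_subset_of_rk_le G.2.1 K.2.1.subset_ground h1
        (hmin G (Finset.mem_filter.2 ⟨hG, hFG⟩))]
      exact hjK

/-- To remove a square `x_F^2`, take `i` in `F` outside the preceding member of the flag and `j`
outside `F` inside the next one. Any other member of `s` contains both or neither, so multiplying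
`α_i - α_j = 0` by the monomial expresses the square through flats not in `s`. -/
theorem chowVar_mul_flagClass_mem [M.Loopless] {s : Finset (ProperFlat M)} (hs : IsFlag s)
    (F : ProperFlat M) : chowVar M F * flagClass s ∈ flagSpan M (s.card + 1) := by
  classical
  by_cases hF : F ∈ s
  swap
  · exact chowVar_mul_flagClass_mem_of_notMem hF
  obtain ⟨i, hiF, hi⟩ := hs.exists_mem_notMem F
  obtain ⟨j, hjE, hjF, hj⟩ := hs.exists_notMem_mem F
  have h0 : (hyperplaneClass M i - hyperplaneClass M j) * flagClass s = 0 := by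
    rw [hyperplaneClass_eq M (F.2.1.subset_ground hiF) hjE, sub_self, zero_mul]
  rw [hyperplaneClass_eq_sum, hyperplaneClass_eq_sum, Finset.sum_filter, Finset.sum_filter,
    ← Finset.sum_sub_distrib, Finset.sum_mul, ← Finset.add_sum_erase _ _ (Finset.mem_univ F),
    if_pos hiF, if_neg hjF, sub_zero] at h0
  rw [eq_neg_of_add_eq_zero_left h0]
  refine neg_mem (sum_mem fun G hG => ?_)
  have hne := Finset.ne_of_mem_erase hG
  by_cases hGs : G ∈ s
  · rcases hs.subset_or_subset hGs hF with h | h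
    · have hss := h.ssubset_of_ne fun h => hne (Subtype.ext h)
      rw [if_neg (hi G hGs hss), if_neg fun h' => hjF (h h'), sub_self, zero_mul]
      exact zero_mem _
    · have hss := h.ssubset_of_ne fun h => hne (Subtype.ext h.symm)
      rw [if_pos (h hiF), if_pos (hj G hGs hss), sub_self, zero_mul]
      exact zero_mem _
  · have := chowVar_mul_flagClass_mem_of_notMem hGs
    rw [sub_mul]
    refine sub_mem ?_ ?_ <;> split_ifs <;> simp [this]

theorem chowVar_mul_mem_flagSpan [M.Loopless] (F : ProperFlat M) {d : ℕ} {x : ChowRing M}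
    (hx : x ∈ flagSpan M d) : chowVar M F * x ∈ flagSpan M (d + 1) := by
  induction hx using Submodule.span_induction with
  | mem x h =>
    obtain ⟨s, hs, rfl, rfl⟩ := h
    exact chowVar_mul_flagClass_mem hs F
  | zero => simp
  | add x y _ _ hx hy => rw [mul_add]; exact add_mem hx hy
  | smul c x _ hx => rw [mul_smul_comm]; exact Submodule.smul_mem _ c hx

theorem toChow_monomial_mul_mem_flagSpan [M.Loopless] (m : ProperFlat M →₀ ℕ) :
    ∀ {d : ℕ} {x : ChowRing M}, x ∈ flagSpan M d →
      toChow M (monomial m 1) * x ∈ flagSpan M (m.degree + d) := by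
  induction m using Finsupp.induction_linear with
  | zero => intro d x hx; simpa using hx
  | add f g hf hg =>
    intro d x hx
    rw [show (monomial (f + g) 1 : MvPolynomial (ProperFlat M) ℝ) = monomial f 1 * monomial g 1 by
      simp [monomial_mul], map_mul, mul_assoc, map_add, add_assoc]
    exact hf (hg hx)
  | single F n =>
    intro d x hx
    rw [← X_pow_eq_monomial, map_pow, Finsupp.degree_single]
    induction n with
    | zero => simpa using hx
    | succ n ih =>
      rw [pow_succ', mul_assoc, add_right_comm]
      exact chowVar_mul_mem_flagSpan F ih

theorem chowGraded_le_flagSpan [M.Loopless] (d : ℕ) : chowGraded M d ≤ flagSpan M d := by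
  rintro _ ⟨p, hp, rfl⟩
  rw [p.as_sum, map_sum]
  refine sum_mem fun m hm => ?_
  have hd : m.degree = d := by
    rw [Finsupp.degree_eq_weight_one]
    exact hp (mem_support_iff.1 hm)
  have h1 : (1 : ChowRing M) ∈ flagSpan M 0 :=
    Submodule.subset_span ⟨∅, by simp [IsFlag], rfl, by simp [flagClass]⟩
  have h2 := toChow_monomial_mul_mem_flagSpan m h1
  rw [mul_one, add_zero, hd] at h2
  rw [show monomial m (coeff m p) = coeff m p • monomial m (1 : ℝ) by simp [smul_monomial],
    map_smul]
  exact Submodule.smul_mem _ _ h2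

theorem flagSpan_le_span_singleton [M.Loopless] {r : ℕ} (hr : rk M M.E = r + 1) {e : α}
    (he : e ∈ M.E) : flagSpan M r ≤ Submodule.span ℝ {hyperplaneClass M e ^ r} := by
  refine Submodule.span_le.2 ?_
  rintro _ ⟨s, hs, hc, rfl⟩
  rw [flagClass_of_card_eq hr he hs hc]
  exact Submodule.mem_span_singleton_self _

theorem chowGraded_eq_span_singleton [M.Loopless] {r : ℕ} (hr : rk M M.E = r + 1) {e : α}
    (he : e ∈ M.E) : chowGraded M r = Submodule.span ℝ {hyperplaneClass M e ^ r} := by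
  refine ((chowGraded_le_flagSpan r).trans (flagSpan_le_span_singleton hr he)).antisymm ?_
  rw [Submodule.span_singleton_le_iff_mem]
  simpa using class_mem_chowGraded M (Nat.zero_le r) e e

/-- Without a complete flag the spanning set in degree `r` would be empty, against `α^r ≠ 0`. -/
theorem exists_isFlag_card_eq [M.Loopless] {r : ℕ} (hr : rk M M.E = r + 1) {e : α}
    (he : e ∈ M.E) : ∃ s : Finset (ProperFlat M), IsFlag s ∧ s.card = r := by
  by_contra! h
  refine hyperplaneClass_pow_ne_zero hr he ?_
  have h1 : hyperplaneClass M e ^ r ∈ flagSpan M r := chowGraded_le_flagSpan r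
    (by simpa using class_mem_chowGraded M (Nat.zero_le r) e e)
  have h2 : {x | ∃ s : Finset (ProperFlat M), IsFlag s ∧ s.card = r ∧ flagClass s = x} = ∅ :=
    Set.eq_empty_of_forall_notMem fun _ ⟨s, hs, hc, _⟩ => h s hs hc
  rwa [flagSpan, h2, Submodule.span_empty, Submodule.mem_bot] at h1

end Spanning

/-! ### The degree isomorphism -/

section DegreeEquiv

variable {α : Type*} {M : Matroid α} [M.Finite] [M.Loopless] {r : ℕ} {e : α}

/-- The degree isomorphism, normalized by the power of the hyperplane class. -/
def degreeEquiv (hr : rk M M.E = r + 1) (he : e ∈ M.E) : chowGraded M r ≃ₗ[ℝ] ℝ :=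
  (LinearEquiv.ofEq _ _ (chowGraded_eq_span_singleton hr he)).trans
    (LinearEquiv.toSpanNonzeroSingleton ℝ _ _ (hyperplaneClass_pow_ne_zero hr he)).symm

theorem degreeEquiv_apply (hr : rk M M.E = r + 1) (he : e ∈ M.E) {x : ChowRing M}
    (hx : x ∈ chowGraded M r) {c : ℝ} (h : x = c • hyperplaneClass M e ^ r) :
    degreeEquiv hr he ⟨x, hx⟩ = c := by
  rw [degreeEquiv, LinearEquiv.trans_apply, LinearEquiv.symm_apply_eq]
  exact Subtype.ext h

theorem isDegreeMap_degreeEquiv (hr : rk M M.E = r + 1) (he : e ∈ M.E) :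
    IsDegreeMap M r (degreeEquiv hr he).toLinearMap := by
  intro s hs
  refine degreeEquiv_apply hr he _ ?_
  split_ifs with h
  · rw [one_smul]
    exact flagClass_of_card_eq hr he h hs
  · rw [zero_smul]
    exact flagClass_eq_zero h

/-- A complete flag monomial is the generator `α^r`, so its prescribed value `1` fixes the
functional. -/
theorem IsDegreeMap.eq_degreeEquiv (hr : rk M M.E = r + 1) (he : e ∈ M.E)
    {deg : chowGraded M r →ₗ[ℝ] ℝ} (hdeg : IsDegreeMap M r deg) :
    deg = (degreeEquiv hr he).toLinearMap := by
  obtain ⟨s, hs, hc⟩ := exists_isFlag_card_eq hr he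
  have h1 := hdeg s hc
  rw [if_pos hs] at h1
  ext ⟨x, hx⟩
  obtain ⟨c, rfl⟩ := Submodule.mem_span_singleton.1 (chowGraded_eq_span_singleton hr he ▸ hx)
  refine Eq.trans ?_ (degreeEquiv_apply hr he hx rfl).symm
  have h2 : (⟨c • hyperplaneClass M e ^ r, hx⟩ : chowGraded M r) =
      c • ⟨∏ F ∈ s, chowVar M F, prod_mem_chowGraded M s hc⟩ :=
    Subtype.ext (by
      change _ = c • flagClass s
      rw [flagClass_of_card_eq hr he hs hc])
  rw [h2, map_smul, h1, smul_eq_mul, mul_one]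

end DegreeEquiv

end MatroidChow

end

theorem theorem1p1 {α : Type*} (M : Matroid α) [M.Finite] [M.Loopless] (r : ℕ)
    (hr : M.eRank = (r + 1 : ℕ)) :
    ∃ deg : MatroidChow.chowGraded M r ≃ₗ[ℝ] ℝ,
      MatroidChow.IsDegreeMap M r deg.toLinearMap ∧
      (∀ deg' : MatroidChow.chowGraded M r →ₗ[ℝ] ℝ,
        MatroidChow.IsDegreeMap M r deg' → deg' = deg.toLinearMap) ∧
      ∀ (k : ℕ) (hk : k ≤ r), ∀ i ∈ M.E, ∀ j ∈ M.E,
        deg ⟨MatroidChow.hyperplaneClass M i ^ (r - k) * MatroidChow.reciprocalClass M j ^ k,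
            MatroidChow.class_mem_chowGraded M hk i j⟩ =
          (MatroidChow.mu M r k : ℝ) := by
  have hrk : MatroidChow.rk M M.E = r + 1 := by
    rw [MatroidChow.rk, M.eRk_ground, hr, ENat.toNat_natCast]
  obtain ⟨e, he⟩ : M.E.Nonempty := Set.nonempty_iff_ne_empty.2 fun h => by
    rw [h, MatroidChow.rk_empty] at hrk
    omega
  refine ⟨MatroidChow.degreeEquiv hrk he, MatroidChow.isDegreeMap_degreeEquiv hrk he,
    fun deg' h => h.eq_degreeEquiv hrk he, fun k hk i hi j hj => ?_⟩
  refine MatroidChow.degreeEquiv_apply hrk he _ ?_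
  rw [MatroidChow.hyperplaneClass_eq M hi he, MatroidChow.reciprocalClass_eq M hj he]
  exact MatroidChow.pow_mul_pow_eq_mu_smul hrk he hk
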